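/- Let $\Bbbk$ be a field and let $H$ be a finite-dimensional Hopf algebra over $\Bbbk$ with comultiplication $\Delta$ (written $\Delta(x)=x_{(1)}\otimes x_{(2)}$), counit $\varepsilon$ and antipode $S$. Let $H$ be ribbon, that is, endowed with an invertible $R=\sum_i a_i\otimes b_i\in H\otimes H$ such that $R\,\Delta(x)=\sigma\Delta(x)\,R$ for all $x\in H$ (where $\sigma$ is the flip), $(\mathrm{id}\otimes\Delta)(R)=R_{13}R_{12}$ and $(\Delta\otimes\mathrm{id})(R)=R_{13}R_{23}$, and with an invertible central $\theta\in H$ such that $S(\theta)=\theta$ and $\Delta(\theta)=(\theta\otimes\theta)R_{21}R$. Put $u=\sum_i S(b_i)a_i$ and $G=\theta u$. A left (right) integral for $H$ is an element $\Lambda\in H$ with $x\Lambda=\varepsilon(x)\Lambda$ (resp. $\Lambda x=\varepsilon(x)\Lambda$) for all $x\in H$; $H$ is unimodular if its left and right integrals coincide. A right integral for $H^*$ is a form $\lambda\in H^*$ with $\lambda(x_{(1)})x_{(2)}=\lambda(x)1$ for all $x\in H$. A trace on $H$ is a form $t\in H^*$ with $t(xy)=t(yx)$ and $t(S(x))=t(x)$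 for all $x,y\in H$. There exist a non-zero right integral $\lambda$ for $H^*$ and a unique algebra morphism $\nu:H\to\Bbbk$ such that $\Lambda x=\nu(x)\Lambda$ for every left integral $\Lambda$ for $H$ and every $x\in H$. For $x,z\in H$ and $f \in H^*$ set $x\leftharpoonup\nu=\nu(x_{(1)})x_{(2)}$, $(f\cdot z)(x)=f(zx)$, $h_\nu=(\mathrm{id}\otimes\nu)(R)$, $T(z)=(S(z)\leftharpoonup\nu)\,h_\nu$, and $$L(H)=\{z\in H \mid (x\leftharpoonup\nu)z=zx\text{ for all }x\in H\}.$$ Then, for this $\nu$ and every non-zero right integral $\lambda$ for $H^*$, the map $z\mapsto\lambda\cdot(zG)$ is a $\Bbbk$-linear isomorphism from $\{z\in L(H)\mid T(z)=z\}$ onto the space of traces on $H$. If moreover $H$ is unimodular, then $L(H)$ is the center $Z(H)$ and $T=S$, so that $z\mapsto\lambda\cdot(zG)$ is a $\Bbbk$-linear isomorphism from $\{z\in Z(H)\mid S(z)=z\}$ onto the space of traces on $H$. -/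

import Mathlib

open scoped TensorProduct

noncomputable section

namespace RibbonHopf

variable (k H : Type*) [Field k] [Ring H] [HopfAlgebra k H]

/-- The flip map of `H ⊗ H`. -/
def flip : H ⊗[k] H →ₗ[k] H ⊗[k] H := (TensorProduct.comm k H H).toLinearMap

/-- `a ⊗ b ↦ a ⊗ b ⊗ 1`. -/
def leg12 : H ⊗[k] H →ₐ[k] H ⊗[k] (H ⊗[k] H) :=
  Algebra.TensorProduct.map (AlgHom.id k H) Algebra.TensorProduct.includeLeft

/-- `a ⊗ b ↦ a ⊗ 1 ⊗ b`. -/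
def leg13 : H ⊗[k] H →ₐ[k] H ⊗[k] (H ⊗[k] H) :=
  Algebra.TensorProduct.map (AlgHom.id k H) Algebra.TensorProduct.includeRight

/-- `a ⊗ b ↦ 1 ⊗ a ⊗ b`. -/
def leg23 : H ⊗[k] H →ₐ[k] H ⊗[k] (H ⊗[k] H) :=
  Algebra.TensorProduct.includeRight

/-- A quasitriangular structure (an R-matrix) on the Hopf algebra `H`. -/
structure QuasitriangularStructure where
  /-- the R-matrix -/
  R : H ⊗[k] H
  isUnit_R : IsUnit R
  R_mul_comul : ∀ x : H,
    R * Coalgebra.comul (R := k) x = flip k H (Coalgebra.comul (R := k) x) * R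
  lTensor_comul_R :
    (Coalgebra.comul (R := k) (A := H)).lTensor H R = leg13 k H R * leg12 k H R
  rTensor_comul_R :
    TensorProduct.assoc k H H H ((Coalgebra.comul (R := k) (A := H)).rTensor H R) =
      leg13 k H R * leg23 k H R

/-- A ribbon structure on the Hopf algebra `H`: an R-matrix together with a twist `θ`. -/
structure RibbonStructure extends QuasitriangularStructure k H where
  /-- the twist -/
  θ : H
  isUnit_θ : IsUnit θ
  θ_central : ∀ x : H, θ * x = x * θ
  antipode_θ : HopfAlgebra.antipode k θ = θ
  comul_θ : Coalgebra.comul (R := k) θ = (θ ⊗ₜ[k] θ) * (flip k H R * R)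

variable {k H}

/-- The Drinfeld element `u = ∑ S(bᵢ) aᵢ` of `R = ∑ aᵢ ⊗ bᵢ`. -/
def QuasitriangularStructure.drinfeld (Q : QuasitriangularStructure k H) : H :=
  LinearMap.mul' k H ((HopfAlgebra.antipode k (A := H)).rTensor H (flip k H Q.R))

/-- The special grouplike element `G = θ u`. -/
def RibbonStructure.specialGrouplike (B : RibbonStructure k H) : H :=
  B.θ * B.drinfeld

/-- `Λ` is a left integral for `H`. -/
def IsLeftIntegral (k : Type*) {H : Type*} [Field k] [Ring H] [HopfAlgebra k H] (Λ : H) : Prop :=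
  ∀ x : H, x * Λ = Coalgebra.counit (R := k) x • Λ

/-- `Λ` is a right integral for `H`. -/
def IsRightIntegral (k : Type*) {H : Type*} [Field k] [Ring H] [HopfAlgebra k H] (Λ : H) : Prop :=
  ∀ x : H, Λ * x = Coalgebra.counit (R := k) x • Λ

/-- `H` is unimodular: its integrals are two-sided. -/
def IsUnimodular (k H : Type*) [Field k] [Ring H] [HopfAlgebra k H] : Prop :=
  ∀ Λ : H, IsLeftIntegral k Λ ↔ IsRightIntegral k Λ

/-- `x ↼ f = f(x₍₁₎) x₍₂₎`, as a linear endomorphism in `x`. -/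
def hit (f : Module.Dual k H) : H →ₗ[k] H :=
  (TensorProduct.lid k H).toLinearMap ∘ₗ f.rTensor H ∘ₗ Coalgebra.comul

/-- `f` is a right integral for the dual `H^*`: `f(x₍₁₎) x₍₂₎ = f(x) 1` for all `x`. -/
def IsRightDualIntegral (f : Module.Dual k H) : Prop :=
  ∀ x : H, hit f x = f x • (1 : H)

/-- `ν` is the distinguished grouplike element of `H^*`: the algebra map `H → k` with
`Λ x = ν(x) Λ` for every left integral `Λ` for `H` and every `x`. -/
def IsDistinguishedGrouplike (ν : H →ₐ[k] k) : Prop :=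
  ∀ Λ : H, IsLeftIntegral k Λ → ∀ x : H, Λ * x = ν x • Λ

/-- The right action of `H` on `H^*`: `(f · a)(x) = f(a x)`. -/
def dualAct (f : Module.Dual k H) (a : H) : Module.Dual k H :=
  f ∘ₗ LinearMap.mulLeft k a

/-- `L(H) = {z | (x ↼ ν) z = z x for all x}`. -/
def twistedCenter (ν : H →ₐ[k] k) : Submodule k H where
  carrier := {z | ∀ x : H, hit ν.toLinearMap x * z = z * x}
  add_mem' := fun ha hb x => by rw [mul_add, add_mul, ha x, hb x]
  zero_mem' := fun x => by rw [mul_zero, zero_mul]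
  smul_mem' := fun c z hz x => by rw [mul_smul_comm, smul_mul_assoc, hz x]

/-- `h_ν = (id ⊗ ν)(R)`. -/
def QuasitriangularStructure.hElem (Q : QuasitriangularStructure k H) (ν : H →ₐ[k] k) : H :=
  TensorProduct.rid k H (ν.toLinearMap.lTensor H Q.R)

/-- `T(z) = (S(z) ↼ ν) h_ν`. -/
def QuasitriangularStructure.T (Q : QuasitriangularStructure k H) (ν : H →ₐ[k] k) : H →ₗ[k] H :=
  LinearMap.mulRight k (Q.hElem ν) ∘ₗ hit ν.toLinearMap ∘ₗ HopfAlgebra.antipode k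

variable (k H) in
/-- The space of traces on `H`: the forms `t` with `t(xy) = t(yx)` and `t(S(x)) = t(x)`. -/
def traceSpace : Submodule k (Module.Dual k H) where
  carrier := {t | (∀ x y : H, t (x * y) = t (y * x)) ∧
    ∀ x : H, t (HopfAlgebra.antipode k x) = t x}
  add_mem' := fun ha hb =>
    ⟨fun x y => by rw [LinearMap.add_apply, LinearMap.add_apply, ha.1 x y, hb.1 x y],
      fun x => by rw [LinearMap.add_apply, LinearMap.add_apply, ha.2 x, hb.2 x]⟩
  zero_mem' := ⟨fun _ _ => rfl, fun _ => rfl⟩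
  smul_mem' := fun c t ht =>
    ⟨fun x y => by rw [LinearMap.smul_apply, LinearMap.smul_apply, ht.1 x y],
      fun x => by rw [LinearMap.smul_apply, LinearMap.smul_apply, ht.2 x]⟩

/-- `P` is mapped isomorphically onto the space of traces on `H` by `z ↦ f · (z G)`. -/
def ParametrizesTraces (P : Submodule k H) (f : Module.Dual k H) (G : H) : Prop :=
  ∃ e : P ≃ₗ[k] traceSpace k H,
    ∀ z : P, (e z : Module.Dual k H) = dualAct f ((z : H) * G)

end RibbonHopf

end

noncomputable section

namespace RibbonHopf

open Coalgebra HopfAlgebra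

/-! ### Sweedler identities, the antipode and contractions with forms. -/

section HopfBasics

variable {k H : Type*} [Field k] [Ring H] [HopfAlgebra k H]

/-! A non-zero right integral λ for H* makes H a Frobenius algebra: a ↦ λ(a ·) is injective, hence
bijective onto H* (`IsRightDualIntegral.exists_dualAct_eq`). As G is invertible, with inverse S(G),
every form on H is λ·(zG) for exactly one z. It remains to translate the two trace conditions into
conditions on z.

Cyclicity is controlled by the Nakayama automorphism: λ(ay) = λ(S²(y↼ν)a)
(`IsRightDualIntegral.apply_mul_comm`). Since Gy = S²(y)G, comparing λ(zGxy) with λ(zGyx) gives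
(S²(y)↼ν)z = zS²(y) for all y, that is, z ∈ L(H), because S² is onto.

Invariance under S rests on λ∘S = λ·(h_ν G²) (`RibbonStructure.apply_antipode`). To get it, take a
left integral Λ with λ(Λ) = 1 and contract RΔ(Λ) = σΔ(Λ)R with id ⊗ λS; this expresses λ∘S through
u, S(u) and h_ν, and θ²uS(u) = 1 converts the result into G. For z ∈ L(H), invariance then reads
T(z) = z.

The existence of λ comes from traces: x ↦ Tr(y ↦ S²(f(y₍₁₎)y₍₂₎)x) is a right integral for every
form f, and these integrals cannot all vanish. In the unimodular case ν = ε, so ↼ν is the identity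
and h_ν = 1. -/

theorem sum_comul_mul_one_tmul_antipode (x : H) :
    ∑ i ∈ (ℛ k x).index,
      comul (R := k) ((ℛ k x).left i) * (1 ⊗ₜ[k] antipode k ((ℛ k x).right i)) = x ⊗ₜ[k] 1 := by
  have h := congrArg ((LinearMap.mul' k H ∘ₗ (antipode k).lTensor H).lTensor H)
    (sum_tmul_tmul_eq (ℛ k x) (fun i => ℛ k _) (fun i => ℛ k _))
  simp only [map_sum, LinearMap.lTensor_tmul, LinearMap.comp_apply, LinearMap.mul'_apply,
    ← TensorProduct.tmul_sum, sum_mul_antipode_eq_algebraMap_counit] at h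
  have h2 : ∑ i ∈ (ℛ k x).index,
      (ℛ k x).left i ⊗ₜ[k] algebraMap k H (counit ((ℛ k x).right i)) = x ⊗ₜ[k] 1 := by
    simpa only [map_sum, LinearMap.lTensor_tmul, Algebra.linearMap_apply, map_one] using
      congrArg ((Algebra.linearMap k H).lTensor H) (sum_tmul_counit_eq (ℛ k x))
  rw [← h2, ← h]
  refine Finset.sum_congr rfl fun i _ => ?_
  rw [← (ℛ k ((ℛ k x).left i)).eq, Finset.sum_mul]
  simp

theorem sum_antipode_tmul_one_mul_comul (x : H) :
    ∑ i ∈ (ℛ k x).index,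
      (antipode k ((ℛ k x).left i) ⊗ₜ[k] 1) * comul (R := k) ((ℛ k x).right i) = 1 ⊗ₜ[k] x := by
  have h := congrArg ((LinearMap.mul' k H ∘ₗ (antipode k).rTensor H).rTensor H ∘ₗ
      (TensorProduct.assoc k H H H).symm.toLinearMap)
    (sum_tmul_tmul_eq (ℛ k x) (fun i => ℛ k _) (fun i => ℛ k _))
  simp only [map_sum, LinearMap.rTensor_tmul, LinearMap.comp_apply, LinearMap.mul'_apply,
    LinearEquiv.coe_coe, TensorProduct.assoc_symm_tmul,
    ← TensorProduct.sum_tmul, sum_antipode_mul_eq_algebraMap_counit] at h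
  have h2 : ∑ i ∈ (ℛ k x).index,
      algebraMap k H (counit ((ℛ k x).left i)) ⊗ₜ[k] (ℛ k x).right i = 1 ⊗ₜ[k] x := by
    simpa only [map_sum, LinearMap.rTensor_tmul, Algebra.linearMap_apply, map_one] using
      congrArg ((Algebra.linearMap k H).rTensor H) (sum_counit_tmul_eq (ℛ k x))
  rw [← h2, h]
  refine Finset.sum_congr rfl fun i _ => ?_
  rw [← (ℛ k ((ℛ k x).right i)).eq, Finset.mul_sum]
  simp

/-- Both sides are convolution inverses of Δ in Hom(H, H ⊗ H). The right-hand side is the product of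
y ↦ 1 ⊗ S(y) and y ↦ S(y) ⊗ 1, which cancel the two legs of Δ one after the other. -/
theorem comul_antipode (x : H) :
    comul (R := k) (antipode k x) =
      TensorProduct.comm k H H (TensorProduct.map (antipode k) (antipode k) (comul x)) := by
  let A : WithConv (H →ₗ[k] H ⊗[k] H) := WithConv.toConv (TensorProduct.mk k H H 1 ∘ₗ antipode k)
  let B : WithConv (H →ₗ[k] H ⊗[k] H) :=
    WithConv.toConv ((TensorProduct.mk k H H).flip 1 ∘ₗ antipode k)
  let J : WithConv (H →ₗ[k] H ⊗[k] H) := WithConv.toConv (TensorProduct.mk k H H 1)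
  have hBD : B * WithConv.toConv (comul (R := k) (A := H)) = J := by
    ext y
    rw [(ℛ k y).convMul_apply]
    simpa [B, J] using sum_antipode_tmul_one_mul_comul (k := k) y
  have hAJ : A * J = 1 := by
    ext y
    rw [(ℛ k y).convMul_apply]
    simp [A, J, ← TensorProduct.tmul_sum, sum_antipode_mul_eq_algebraMap_counit,
      Algebra.algebraMap_eq_smul_one, Algebra.TensorProduct.one_def]
  have h1 : A * B * WithConv.toConv (comul (R := k) (A := H)) = 1 := by
    rw [mul_assoc, hBD, hAJ]
  have h2 := left_inv_eq_right_inv h1 LinearMap.comul_right_inv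
  have h3 := congrArg (fun f : WithConv (H →ₗ[k] H ⊗[k] H) => f x) h2
  simp only [(ℛ k x).convMul_apply] at h3
  conv_rhs => rw [← (ℛ k x).eq]
  simpa [A, B, map_sum] using h3.symm

theorem comul_antipode_antipode (x : H) :
    comul (R := k) (antipode k (antipode k x)) =
      TensorProduct.map (antipode k ∘ₗ antipode k) (antipode k ∘ₗ antipode k) (comul x) := by
  rw [comul_antipode, comul_antipode, ← (ℛ k x).eq]
  simp [map_sum]

theorem sum_one_tmul_antipode_mul_comul_antipode_antipode (x : H) :
    ∑ i ∈ (ℛ k x).index, (1 ⊗ₜ[k] antipode k ((ℛ k x).right i)) *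
      comul (R := k) (antipode k (antipode k ((ℛ k x).left i))) =
      antipode k (antipode k x) ⊗ₜ[k] 1 := by
  have h := congrArg (TensorProduct.map (antipode k ∘ₗ antipode k)
      (antipode k ∘ₗ LinearMap.mul' k H ∘ₗ (antipode k).rTensor H))
    (sum_tmul_tmul_eq (ℛ k x) (fun i => ℛ k _) (fun i => ℛ k _))
  simp only [map_sum, LinearMap.rTensor_tmul, LinearMap.comp_apply, LinearMap.mul'_apply,
    TensorProduct.map_tmul] at h
  simp only [← TensorProduct.tmul_sum, ← map_sum, sum_antipode_mul_eq_algebraMap_counit,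
    Algebra.algebraMap_eq_smul_one, map_smul, antipode_one] at h
  have h2 : ∑ i ∈ (ℛ k x).index,
      antipode k (antipode k ((ℛ k x).left i)) ⊗ₜ[k] (counit (R := k) ((ℛ k x).right i) • (1 : H))
        = antipode k (antipode k x) ⊗ₜ[k] 1 := by
    simpa only [map_sum, TensorProduct.map_tmul, LinearMap.comp_apply, Algebra.linearMap_apply,
      Algebra.algebraMap_eq_smul_one, one_smul] using congrArg
        (TensorProduct.map (antipode k ∘ₗ antipode k) (Algebra.linearMap k H))
        (sum_tmul_counit_eq (ℛ k x))
  rw [← h2, ← h]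
  refine Finset.sum_congr rfl fun i _ => ?_
  rw [comul_antipode_antipode]
  conv_lhs => rw [← (ℛ k ((ℛ k x).left i)).eq]
  simp [map_sum, Finset.mul_sum, antipode_mul_antidistrib]

/-- `f ⊗ id`, as a map `H ⊗ H → H`. -/
def contractFst (f : Module.Dual k H) : H ⊗[k] H →ₗ[k] H :=
  (TensorProduct.lid k H).toLinearMap ∘ₗ f.rTensor H

/-- `id ⊗ f`, as a map `H ⊗ H → H`. -/
def contractSnd (f : Module.Dual k H) : H ⊗[k] H →ₗ[k] H :=
  (TensorProduct.rid k H).toLinearMap ∘ₗ f.lTensor H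

@[simp] theorem contractFst_tmul (f : Module.Dual k H) (x y : H) :
    contractFst f (x ⊗ₜ[k] y) = f x • y := by simp [contractFst]

@[simp] theorem contractSnd_tmul (f : Module.Dual k H) (x y : H) :
    contractSnd f (x ⊗ₜ[k] y) = f y • x := by simp [contractSnd]

theorem contractFst_mul_one_tmul (f : Module.Dual k H) (X : H ⊗[k] H) (h : H) :
    contractFst f (X * (1 ⊗ₜ[k] h)) = contractFst f X * h := by
  induction X with
  | zero => simp
  | tmul a b => simp
  | add a b ha hb => simp [add_mul, ha, hb]

theorem contractFst_mul_tmul_one (f : Module.Dual k H) (X : H ⊗[k] H) (h : H) :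
    contractFst f (X * (h ⊗ₜ[k] 1)) = contractFst (f ∘ₗ LinearMap.mulRight k h) X := by
  induction X with
  | zero => simp
  | tmul a b => simp
  | add a b ha hb => simp [add_mul, ha, hb]

theorem contractSnd_one_tmul_mul (f : Module.Dual k H) (X : H ⊗[k] H) (h : H) :
    contractSnd f ((1 ⊗ₜ[k] h) * X) = contractSnd (f ∘ₗ LinearMap.mulLeft k h) X := by
  induction X with
  | zero => simp
  | tmul a b => simp
  | add a b ha hb => simp [mul_add, ha, hb]

theorem contractSnd_tmul_one_mul (f : Module.Dual k H) (X : H ⊗[k] H) (h : H) :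
    contractSnd f ((h ⊗ₜ[k] 1) * X) = h * contractSnd f X := by
  induction X with
  | zero => simp
  | tmul a b => simp
  | add a b ha hb => simp [mul_add, ha, hb]

theorem apply_contractFst (f g : Module.Dual k H) (X : H ⊗[k] H) :
    g (contractFst f X) = f (contractSnd g X) := by
  induction X with
  | zero => simp
  | tmul a b => simp [mul_comm]
  | add a b ha hb => simp [ha, hb]

theorem hit_eq (f : Module.Dual k H) (x : H) : hit f x = contractFst f (comul x) := rfl

/-- `f ⇀ x = x₍₁₎ f(x₍₂₎)`, as a linear endomorphism in `x`. -/
def coHit (f : Module.Dual k H) : H →ₗ[k] H := contractSnd f ∘ₗ comul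

theorem coHit_eq (f : Module.Dual k H) (x : H) : coHit f x = contractSnd f (comul x) := rfl

theorem hit_eq_sum (f : Module.Dual k H) (x : H) :
    hit f x = ∑ i ∈ (ℛ k x).index, f ((ℛ k x).left i) • (ℛ k x).right i := by
  rw [hit_eq]; conv_lhs => rw [← (ℛ k x).eq]
  simp

theorem coHit_eq_sum (f : Module.Dual k H) (x : H) :
    coHit f x = ∑ i ∈ (ℛ k x).index, f ((ℛ k x).right i) • (ℛ k x).left i := by
  rw [coHit_eq]; conv_lhs => rw [← (ℛ k x).eq]
  simp

theorem hit_counit (x : H) : hit (counit (R := k) (A := H)) x = x := by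
  rw [hit_eq_sum, sum_counit_smul]

theorem counit_coHit (f : Module.Dual k H) (x : H) : counit (R := k) (coHit f x) = f x := by
  rw [coHit_eq, ← apply_contractFst, ← hit_eq, hit_counit]

theorem hit_comp_coHit (f g : Module.Dual k H) : hit f ∘ₗ coHit g = coHit g ∘ₗ hit f := by
  ext x
  have h := congrArg ((TensorProduct.lid k H).toLinearMap ∘ₗ (TensorProduct.map f (contractSnd g)))
    (sum_tmul_tmul_eq (ℛ k x) (fun i => ℛ k _) (fun i => ℛ k _))
  simp only [map_sum, LinearMap.comp_apply, LinearEquiv.coe_coe, TensorProduct.map_tmul,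
    contractSnd_tmul, TensorProduct.lid_tmul] at h
  rw [LinearMap.comp_apply, LinearMap.comp_apply, coHit_eq_sum g x, hit_eq_sum f x]
  simp only [map_sum, map_smul]
  simp only [hit_eq_sum, coHit_eq_sum, Finset.smul_sum]
  rw [← h]
  refine Finset.sum_congr rfl fun i _ => Finset.sum_congr rfl fun j _ => ?_
  rw [smul_comm]

theorem contractFst_mul (ν : H →ₐ[k] k) (X Y : H ⊗[k] H) : contractFst ν.toLinearMap (X * Y) =
    contractFst ν.toLinearMap X * contractFst ν.toLinearMap Y := by
  induction X with
  | zero => simp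
  | add a b ha hb => simp [add_mul, ha, hb]
  | tmul a b =>
    induction Y with
    | zero => simp
    | add a b ha hb => simp [mul_add, ha, hb]
    | tmul c d => simp [smul_smul, mul_comm]

theorem contractSnd_mul (ν : H →ₐ[k] k) (X Y : H ⊗[k] H) : contractSnd ν.toLinearMap (X * Y) =
    contractSnd ν.toLinearMap X * contractSnd ν.toLinearMap Y := by
  induction X with
  | zero => simp
  | add a b ha hb => simp [add_mul, ha, hb]
  | tmul a b =>
    induction Y with
    | zero => simp
    | add a b ha hb => simp [mul_add, ha, hb]
    | tmul c d => simp [smul_smul, mul_comm]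

theorem contractSnd_one (ν : H →ₐ[k] k) : contractSnd ν.toLinearMap (1 : H ⊗[k] H) = 1 := by
  rw [Algebra.TensorProduct.one_def]
  simp

theorem hit_mul (ν : H →ₐ[k] k) (x y : H) :
    hit ν.toLinearMap (x * y) = hit ν.toLinearMap x * hit ν.toLinearMap y := by
  rw [hit_eq, hit_eq, hit_eq, Bialgebra.comul_mul, contractFst_mul]

theorem hit_one (ν : H →ₐ[k] k) : hit ν.toLinearMap (1 : H) = 1 := by
  rw [hit_eq, Bialgebra.comul_one, Algebra.TensorProduct.one_def]
  simp

end HopfBasics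

/-! ### Existence of a non-zero right integral for H*, by a trace argument. -/

section DualIntegral

variable {k H : Type*} [Field k] [Ring H] [HopfAlgebra k H]

/-- Forms separate points, and p(x ↼ f) = f(p ⇀ x). In this shape the condition can be tested under
a trace. -/
theorem isRightDualIntegral_iff {f : Module.Dual k H} :
    IsRightDualIntegral f ↔ ∀ (p : Module.Dual k H) (x : H), f (coHit p x) = p 1 * f x := by
  have key : ∀ (p : Module.Dual k H) (x : H), p (hit f x) = f (coHit p x) := fun p x => by
    rw [hit_eq, coHit_eq, apply_contractFst]
  constructor
  · intro h p x
    rw [← key, h x, map_smul, smul_eq_mul, mul_comm]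
  · intro h x
    rw [← sub_eq_zero, ← Module.forall_dual_apply_eq_zero_iff k]
    intro p
    rw [map_sub, key, h, map_smul, smul_eq_mul, mul_comm, sub_self]

theorem contractSnd_sum_smul {ι : Type*} (s : Finset ι) (c : ι → k) (f : ι → Module.Dual k H)
    (X : H ⊗[k] H) :
    contractSnd (∑ j ∈ s, c j • f j) X = ∑ j ∈ s, c j • contractSnd (f j) X := by
  induction X with
  | zero => simp
  | tmul a b => simp [Finset.sum_smul, smul_smul]
  | add a b ha hb => simp only [map_add, ha, hb, smul_add, Finset.sum_add_distrib]

section TraceForm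

variable {ι : Type*} [Fintype ι] (b : Module.Basis ι k H)

theorem comp_mulLeft_antipode_eq_sum (p : Module.Dual k H) (r : H) :
    p ∘ₗ LinearMap.mulLeft k (antipode k r) =
      ∑ j, b.coord j r • (p ∘ₗ LinearMap.mulLeft k (antipode k (b j))) := by
  ext x
  have := congrArg (fun z => p (antipode k z * x)) (b.sum_repr r)
  simp only [map_sum, Finset.sum_mul, map_smul, smul_mul_assoc] at this
  rw [LinearMap.sum_apply]
  exact this.symm

theorem coHit_comp_mulLeft_antipode (p : Module.Dual k H) (r y : H) :
    coHit (p ∘ₗ LinearMap.mulLeft k (antipode k r)) y =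
      ∑ j, b.coord j r • coHit (p ∘ₗ LinearMap.mulLeft k (antipode k (b j))) y := by
  rw [comp_mulLeft_antipode_eq_sum b p r, coHit_eq, contractSnd_sum_smul]
  rfl

/-- From S²(w) ⊗ 1 = (1 ⊗ S(w₍₂₎))Δ(S²(w₍₁₎)) one gets S²(w)(p ⇀ x) = p(S(w₍₂₎)·) ⇀ (S²(w₍₁₎)x).
Expanding w₍₂₎ in a basis separates it from w₍₁₎, giving a sum of composites to which cyclicity of
the trace applies. -/
theorem mulRight_coHit_comp (p : Module.Dual k H) (x : H) :
    LinearMap.mulRight k (coHit p x) ∘ₗ antipode k ∘ₗ antipode k =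
      ∑ j, coHit (p ∘ₗ LinearMap.mulLeft k (antipode k (b j))) ∘ₗ
        LinearMap.mulRight k x ∘ₗ antipode k ∘ₗ antipode k ∘ₗ coHit (b.coord j) := by
  ext w
  have h : antipode k (antipode k w) * coHit p x = ∑ i ∈ (ℛ k w).index,
      coHit (p ∘ₗ LinearMap.mulLeft k (antipode k ((ℛ k w).right i)))
        (antipode k (antipode k ((ℛ k w).left i)) * x) := by
    rw [coHit_eq, ← contractSnd_tmul_one_mul, ← sum_one_tmul_antipode_mul_comul_antipode_antipode,
      Finset.sum_mul, map_sum]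
    refine Finset.sum_congr rfl fun i _ => ?_
    rw [mul_assoc, ← Bialgebra.comul_mul, contractSnd_one_tmul_mul, coHit_eq]
  simp only [LinearMap.comp_apply, LinearMap.mulRight_apply, LinearMap.sum_apply, h]
  rw [Finset.sum_congr rfl fun i _ => coHit_comp_mulLeft_antipode b p _ _, Finset.sum_comm]
  refine Finset.sum_congr rfl fun j _ => ?_
  simp only [coHit_eq_sum _ w, map_sum, Finset.sum_mul, map_smul, smul_mul_assoc]

/-- Evaluated at y, the sum is y₍₁₎ p(S(y₍₂₎)y₍₃₎). This is the collapse needed once the trace has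
been rotated. -/
theorem sum_coHit_comp_coHit (p : Module.Dual k H) :
    ∑ j, coHit (b.coord j) ∘ₗ coHit (p ∘ₗ LinearMap.mulLeft k (antipode k (b j))) =
      p 1 • LinearMap.id := by
  ext y
  have h := congrArg ((TensorProduct.rid k H).toLinearMap ∘ₗ
      (p ∘ₗ LinearMap.mul' k H ∘ₗ (antipode k).rTensor H).lTensor H)
    (sum_tmul_tmul_eq (ℛ k y) (fun i => ℛ k _) (fun i => ℛ k _))
  simp only [map_sum, LinearMap.lTensor_tmul, LinearMap.rTensor_tmul, LinearMap.comp_apply,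
    LinearMap.mul'_apply, LinearEquiv.coe_coe, TensorProduct.rid_tmul] at h
  simp only [← Finset.sum_smul, ← map_sum, sum_antipode_mul_eq_algebraMap_counit,
    Algebra.algebraMap_eq_smul_one, map_smul] at h
  have h2 : ∑ i ∈ (ℛ k y).index, (counit (R := k) ((ℛ k y).right i) • p 1) • (ℛ k y).left i =
      p 1 • y := by
    have := congrArg (TensorProduct.rid k H) (sum_tmul_counit_eq (ℛ k y))
    simp only [map_sum, TensorProduct.rid_tmul, one_smul] at this
    conv_rhs => rw [← this]
    rw [Finset.smul_sum]
    exact Finset.sum_congr rfl fun i _ => by rw [smul_smul, smul_eq_mul, mul_comm]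
  rw [LinearMap.sum_apply, LinearMap.smul_apply, LinearMap.id_apply, ← h2, ← h]
  simp_rw [LinearMap.comp_apply, coHit_eq_sum _ y, map_sum, map_smul]
  rw [Finset.sum_comm]
  refine Finset.sum_congr rfl fun i _ => ?_
  simp_rw [coHit_eq_sum, Finset.smul_sum]
  rw [Finset.sum_comm]
  refine Finset.sum_congr rfl fun l _ => ?_
  simp_rw [smul_smul]
  rw [← Finset.sum_smul]
  congr 1
  have := LinearMap.congr_fun
    (comp_mulLeft_antipode_eq_sum b p ((ℛ k ((ℛ k y).left i)).right l)) ((ℛ k y).right i)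
  simp only [LinearMap.comp_apply, LinearMap.mulLeft_apply, LinearMap.sum_apply,
    LinearMap.smul_apply, smul_eq_mul] at this
  rw [this]
  refine Finset.sum_congr rfl fun j _ => ?_
  rw [LinearMap.comp_apply, LinearMap.mulLeft_apply, mul_comm]

end TraceForm

/-- The form `x ↦ Tr(y ↦ S²(f(y₍₁₎) y₍₂₎) x)`. -/
def traceForm (f : Module.Dual k H) : Module.Dual k H :=
  LinearMap.trace k H ∘ₗ LinearMap.lcomp k H (antipode k ∘ₗ antipode k ∘ₗ hit f) ∘ₗ
    (LinearMap.mul k H).flip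

theorem traceForm_apply (f : Module.Dual k H) (x : H) :
    traceForm f x =
      LinearMap.trace k H (LinearMap.mulRight k x ∘ₗ antipode k ∘ₗ antipode k ∘ₗ hit f) := rfl

theorem isRightDualIntegral_traceForm [FiniteDimensional k H] (f : Module.Dual k H) :
    IsRightDualIntegral (traceForm f) := by
  rw [isRightDualIntegral_iff]
  intro p x
  let b := Module.finBasis k H
  have h1 : LinearMap.mulRight k (coHit p x) ∘ₗ antipode k ∘ₗ antipode k ∘ₗ hit f =
      ∑ j, coHit (p ∘ₗ LinearMap.mulLeft k (antipode k (b j))) *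
        (LinearMap.mulRight k x ∘ₗ antipode k ∘ₗ antipode k ∘ₗ hit f ∘ₗ coHit (b.coord j)) := by
    ext w
    have := LinearMap.congr_fun (mulRight_coHit_comp b p x) (hit f w)
    simp only [LinearMap.sum_apply, LinearMap.comp_apply] at this
    simp only [LinearMap.sum_apply, LinearMap.comp_apply, Module.End.mul_apply, this]
    refine Finset.sum_congr rfl fun j _ => ?_
    have h := LinearMap.congr_fun (hit_comp_coHit f (b.coord j)) w
    rw [LinearMap.comp_apply, LinearMap.comp_apply] at h
    rw [h]
  rw [traceForm_apply, traceForm_apply, h1, map_sum]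
  simp_rw [LinearMap.trace_mul_comm k (coHit _)]
  rw [← map_sum, ← smul_eq_mul, ← map_smul]
  congr 1
  ext w
  have h2 := congrArg (LinearMap.mulRight k x ∘ₗ antipode k ∘ₗ antipode k ∘ₗ hit f)
    (LinearMap.congr_fun (sum_coHit_comp_coHit b p) w)
  simpa only [LinearMap.sum_apply, map_sum, LinearMap.comp_apply, LinearMap.smul_apply,
    LinearMap.id_apply, map_smul, Module.End.mul_apply] using h2

/-- The operator `A ↦ (y ↦ S(y₍₂₎) A(y₍₁₎))` on `End H`. -/
def antipodeTwist (k H : Type*) [Field k] [Ring H] [HopfAlgebra k H] :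
    (H →ₗ[k] H) →ₗ[k] (H →ₗ[k] H) where
  toFun A := LinearMap.mul' k H ∘ₗ TensorProduct.map (antipode k) A ∘ₗ
    (TensorProduct.comm k H H).toLinearMap ∘ₗ comul
  map_add' A B := by
    rw [TensorProduct.map_add_right, LinearMap.add_comp, LinearMap.comp_add]
  map_smul' c A := by
    rw [TensorProduct.map_smul_right, LinearMap.smul_comp, LinearMap.comp_smul, RingHom.id_apply]

theorem antipodeTwist_apply (A : H →ₗ[k] H) (y : H) :
    antipodeTwist k H A y =
      ∑ i ∈ (ℛ k y).index, antipode k ((ℛ k y).right i) * A ((ℛ k y).left i) := by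
  change LinearMap.mul' k H (TensorProduct.map (antipode k) A
    (TensorProduct.comm k H H (comul y))) = _
  conv_lhs => rw [← (ℛ k y).eq]
  simp [map_sum]

/-- The twist gives f(y₍₁₎)S(y₍₃₎)S²(y₍₂₎)x = f(y₍₁₎)S(S(y₍₂₎)y₍₃₎)x = f(y)x. Thus the operators
whose traces define `traceForm` are sent to all the rank-one operators. -/
theorem antipodeTwist_mulRight_comp (f : Module.Dual k H) (x : H) :
    antipodeTwist k H (LinearMap.mulRight k x ∘ₗ antipode k ∘ₗ antipode k ∘ₗ hit f) =
      dualTensorHom k H H (f ⊗ₜ x) := by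
  ext y
  have h := congrArg ((TensorProduct.lid k H).toLinearMap ∘ₗ
      TensorProduct.map f (antipode k ∘ₗ LinearMap.mul' k H ∘ₗ (antipode k).rTensor H))
    (sum_tmul_tmul_eq (ℛ k y) (fun i => ℛ k _) (fun i => ℛ k _))
  simp only [map_sum, TensorProduct.map_tmul, LinearMap.rTensor_tmul, LinearMap.comp_apply,
    LinearMap.mul'_apply, LinearEquiv.coe_coe, TensorProduct.lid_tmul] at h
  simp only [← Finset.smul_sum, ← map_sum, sum_antipode_mul_eq_algebraMap_counit,
    Algebra.algebraMap_eq_smul_one, map_smul, antipode_one] at h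
  have h2 : ∑ i ∈ (ℛ k y).index, f ((ℛ k y).left i) • counit (R := k) ((ℛ k y).right i) • (1 : H)
      = f y • 1 := by
    have := congrArg (fun z => f (TensorProduct.rid k H z)) (sum_tmul_counit_eq (ℛ k y))
    simp only [map_sum, TensorProduct.rid_tmul, one_smul, map_smul] at this
    rw [← this, Finset.sum_smul]
    exact Finset.sum_congr rfl fun i _ => by rw [smul_smul, smul_eq_mul, mul_comm]
  rw [antipodeTwist_apply, dualTensorHom_apply, ← one_mul x, ← smul_mul_assoc, ← h2, ← h,
    Finset.sum_mul]
  refine Finset.sum_congr rfl fun i _ => ?_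
  simp only [LinearMap.comp_apply, LinearMap.mulRight_apply, one_mul]
  rw [← mul_assoc, ← antipode_mul_antidistrib, hit_eq_sum]
  simp [map_sum, Finset.sum_mul]

theorem exists_isRightDualIntegral (k H : Type*) [Field k] [Ring H] [HopfAlgebra k H]
    [FiniteDimensional k H] : ∃ f : Module.Dual k H, f ≠ 0 ∧ IsRightDualIntegral f := by
  by_contra hcon
  have hzero : ∀ f : Module.Dual k H, traceForm f = 0 := fun f => by
    by_contra hf
    exact hcon ⟨_, hf, isRightDualIntegral_traceForm f⟩
  -- Rank-one operators span End H, so the twist is onto and, by finite dimension, invertible. If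
  -- every `traceForm` vanished, the trace would vanish on the preimages of all rank-one operators,
  -- hence on all of End H.
  have hsurj : Function.Surjective (antipodeTwist k H) := by
    rw [← LinearMap.range_eq_top, eq_top_iff]
    rintro A -
    obtain ⟨t, rfl⟩ := (dualTensorHom_bijective (R := k) (M := H) (N := H)).2 A
    induction t with
    | zero => rw [map_zero]; exact zero_mem _
    | tmul f x => exact ⟨_, antipodeTwist_mulRight_comp f x⟩
    | add s t hs ht => rw [map_add]; exact add_mem hs ht
  let e := LinearEquiv.ofBijective (antipodeTwist k H)
    ⟨LinearMap.injective_iff_surjective.2 hsurj, hsurj⟩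
  have hvanish : LinearMap.trace k H ∘ₗ e.symm.toLinearMap ∘ₗ dualTensorHom k H H = 0 := by
    refine TensorProduct.ext' fun f x => ?_
    have : e.symm (dualTensorHom k H H (f ⊗ₜ x)) =
        LinearMap.mulRight k x ∘ₗ antipode k ∘ₗ antipode k ∘ₗ hit f := by
      rw [LinearEquiv.symm_apply_eq]
      exact (antipodeTwist_mulRight_comp f x).symm
    rw [LinearMap.comp_apply, LinearMap.comp_apply, LinearEquiv.coe_coe, this, ← traceForm_apply,
      hzero f]
    rfl
  -- The contradiction uses y ↦ ε(y)1, whose trace is 1; the trace of the identity could be zero in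
  -- positive characteristic.
  obtain ⟨t, ht⟩ := (dualTensorHom_bijective (R := k) (M := H) (N := H)).2
    (e (dualTensorHom k H H (counit ⊗ₜ 1)))
  have := LinearMap.congr_fun hvanish t
  rw [LinearMap.comp_apply, LinearMap.comp_apply, ht, LinearEquiv.coe_coe,
    LinearEquiv.symm_apply_apply, LinearMap.trace_eq_contract_apply, contractLeft_apply,
    Bialgebra.counit_one] at this
  exact one_ne_zero this

end DualIntegral

/-! ### Frobenius structure, left integrals and the Nakayama automorphism. -/

section Frobenius

variable {k H : Type*} [Field k] [Ring H] [HopfAlgebra k H]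

/-- The two legs of `Δ(x)(y ⊗ 1)` contracted with a right integral for `H^*`:
`λ(x₍₁₎ y) x₍₂₎ = λ(x y₍₁₎) S(y₍₂₎)`. -/
theorem contractFst_comul_mul_tmul_one {f : Module.Dual k H} (hf : IsRightDualIntegral f)
    (x y : H) :
    contractFst f (comul x * (y ⊗ₜ[k] 1)) =
      ∑ i ∈ (ℛ k y).index, f (x * (ℛ k y).left i) • antipode k ((ℛ k y).right i) := by
  rw [← sum_comul_mul_one_tmul_antipode, Finset.mul_sum, map_sum]
  refine Finset.sum_congr rfl fun i _ => ?_
  rw [← mul_assoc, ← Bialgebra.comul_mul, contractFst_mul_one_tmul, ← hit_eq, hf,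
    smul_mul_assoc, one_mul]

theorem eq_sum_contractSnd_tmul {ι : Type*} [Fintype ι] (b : Module.Basis ι k H) (X : H ⊗[k] H) :
    X = ∑ j, contractSnd (b.coord j) X ⊗ₜ[k] b j := by
  induction X with
  | zero => simp
  | tmul x y =>
    conv_lhs => rw [← b.sum_repr y]
    simp only [contractSnd_tmul, TensorProduct.tmul_sum, TensorProduct.tmul_smul,
      TensorProduct.smul_tmul', Module.Basis.coord_apply]
  | add X Y hX hY =>
    conv_lhs => rw [hX, hY]
    simp only [map_add, TensorProduct.add_tmul, Finset.sum_add_distrib]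

variable {f : Module.Dual k H}

/-- The left radical of (a, x) ↦ f(ax) is stable under p ⇀, because f(a₍₁₎x)a₍₂₎ = f(ax₍₁₎)S(x₍₂₎)
vanishes for a in it. -/
theorem IsRightDualIntegral.coHit_mul_eq_zero (hf : IsRightDualIntegral f) {a : H}
    (ha : ∀ x, f (a * x) = 0) (p : Module.Dual k H) (x : H) : f (coHit p a * x) = 0 := by
  have h1 : f (coHit p a * x) = p (contractFst f (comul a * (x ⊗ₜ[k] 1))) := by
    rw [contractFst_mul_tmul_one, apply_contractFst, ← coHit_eq]
    rfl
  rw [h1, contractFst_comul_mul_tmul_one hf]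
  simp [ha]

theorem IsLeftIntegral.mul_right {Λ : H} (hΛ : IsLeftIntegral k Λ) (x : H) :
    IsLeftIntegral k (Λ * x) := fun y => by rw [← mul_assoc, hΛ, smul_mul_assoc]

theorem IsLeftIntegral.one_tmul_mul_comul {Λ : H} (hΛ : IsLeftIntegral k Λ) (b : H) :
    (1 ⊗ₜ[k] b) * comul (R := k) Λ = (antipode k b ⊗ₜ[k] 1) * comul Λ := by
  have h : ∑ i ∈ (ℛ k b).index, counit (R := k) ((ℛ k b).right i) • (ℛ k b).left i = b := by
    rw [← coHit_eq_sum]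
    simp [coHit_eq, contractSnd]
  conv_rhs => rw [← h]
  rw [← sum_antipode_tmul_one_mul_comul, Finset.sum_mul]
  simp only [mul_assoc, ← Bialgebra.comul_mul, hΛ _, map_smul, mul_smul_comm, map_sum,
    TensorProduct.sum_tmul, Finset.sum_mul, ← TensorProduct.smul_tmul', smul_mul_assoc]

theorem IsLeftIntegral.comul_mul_tmul_one {Λ : H} (hΛ : IsLeftIntegral k Λ) {ν : H →ₐ[k] k}
    (hν : IsDistinguishedGrouplike ν) (y : H) :
    comul (R := k) Λ * (y ⊗ₜ[k] 1) =
      comul Λ * (1 ⊗ₜ[k] antipode k (hit ν.toLinearMap y)) := by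
  rw [← sum_comul_mul_one_tmul_antipode, Finset.mul_sum, hit_eq_sum]
  simp only [← mul_assoc, ← Bialgebra.comul_mul, hν Λ hΛ, map_smul, mul_smul_comm, map_sum,
    TensorProduct.tmul_sum, Finset.mul_sum, TensorProduct.tmul_smul, smul_mul_assoc]
  rfl

/-- The sum equals f(x₍₁₎Λ)x₍₂₎ = ε(x₍₁₎)x₍₂₎. So Λ₍₁₎ and S(Λ₍₂₎) are dual bases for the Frobenius
form. -/
theorem IsLeftIntegral.sum_apply_mul_smul_antipode (hf : IsRightDualIntegral f) {Λ : H}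
    (hΛ : IsLeftIntegral k Λ) (h1 : f Λ = 1) (x : H) :
    ∑ i ∈ (ℛ k Λ).index, f (x * (ℛ k Λ).left i) • antipode k ((ℛ k Λ).right i) = x := by
  rw [← contractFst_comul_mul_tmul_one hf, contractFst_mul_tmul_one]
  have : f ∘ₗ LinearMap.mulRight k Λ = counit := by
    ext y
    simp [hΛ y, h1]
  rw [this, ← hit_eq, hit_counit]

variable [FiniteDimensional k H]

/-- For c in the radical, all first legs of Δ(c) lie there too, so ε(c)f(x) = f(c₍₁₎S(c₍₂₎)x) = 0
and ε(c) = 0. Applying this to p ⇀ a gives p(a) = ε(p ⇀ a) = 0 for every p. -/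
theorem IsRightDualIntegral.eq_zero_of_forall_mul (hf : IsRightDualIntegral f) (hf0 : f ≠ 0) {a : H}
    (ha : ∀ x, f (a * x) = 0) : a = 0 := by
  have counit_zero : ∀ c : H, (∀ x, f (c * x) = 0) → counit (R := k) c = 0 := by
    intro c hc
    obtain ⟨x, hx⟩ : ∃ x, f x ≠ 0 := by
      by_contra h
      push Not at h
      exact hf0 (LinearMap.ext h)
    have h1 := mul_antipode_lTensor_comul_apply (R := k) c
    rw [eq_sum_contractSnd_tmul (Module.finBasis k H) (comul c)] at h1
    simp only [map_sum, LinearMap.lTensor_tmul, LinearMap.mul'_apply, ← coHit_eq] at h1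
    have h2 := congrArg (fun z => f (z * x)) h1
    simp only [Finset.sum_mul, map_sum, mul_assoc, hf.coHit_mul_eq_zero hc, Finset.sum_const_zero,
      Algebra.algebraMap_eq_smul_one, smul_mul_assoc, one_mul, map_smul, smul_eq_mul] at h2
    exact (mul_eq_zero.1 h2.symm).resolve_right hx
  rw [← Module.forall_dual_apply_eq_zero_iff k]
  intro p
  rw [← counit_coHit]
  exact counit_zero _ (hf.coHit_mul_eq_zero ha p)

theorem IsRightDualIntegral.exists_dualAct_eq (hf : IsRightDualIntegral f) (hf0 : f ≠ 0)
    (g : Module.Dual k H) : ∃ a : H, ∀ x, f (a * x) = g x := by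
  let D : H →ₗ[k] Module.Dual k H := (LinearMap.mul k H).compr₂ f
  have hD : Function.Surjective D :=
    (LinearMap.injective_iff_surjective_of_finrank_eq_finrank Subspace.dual_finrank_eq.symm).1
      (LinearMap.ker_eq_bot.1 (LinearMap.ker_eq_bot'.2 fun a ha =>
        hf.eq_zero_of_forall_mul hf0 fun x => LinearMap.congr_fun ha x))
  obtain ⟨a, ha⟩ := hD g
  exact ⟨a, fun x => LinearMap.congr_fun ha x⟩

theorem IsRightDualIntegral.eq_of_forall_mul_left (hf : IsRightDualIntegral f) (hf0 : f ≠ 0)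
    {a b : H} (h : ∀ x, f (a * x) = f (b * x)) : a = b := by
  rw [← sub_eq_zero]
  exact hf.eq_zero_of_forall_mul hf0 fun x => by rw [sub_mul, map_sub, h, sub_self]

theorem IsRightDualIntegral.eq_of_forall_mul_right (hf : IsRightDualIntegral f) (hf0 : f ≠ 0)
    {a b : H} (h : ∀ x, f (x * a) = f (x * b)) : a = b := by
  rw [← sub_eq_zero, ← Module.forall_dual_apply_eq_zero_iff k]
  intro g
  obtain ⟨c, hc⟩ := hf.exists_dualAct_eq hf0 g
  rw [← hc, mul_sub, map_sub, h, sub_self]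

theorem IsRightDualIntegral.exists_isLeftIntegral (hf : IsRightDualIntegral f) (hf0 : f ≠ 0) :
    ∃ Λ : H, IsLeftIntegral k Λ ∧ f Λ = 1 := by
  let D : H →ₗ[k] Module.Dual k H := (LinearMap.mul k H).flip.compr₂ f
  have hD : Function.Surjective D :=
    (LinearMap.injective_iff_surjective_of_finrank_eq_finrank Subspace.dual_finrank_eq.symm).1
      (LinearMap.ker_eq_bot.1 (LinearMap.ker_eq_bot'.2 fun a ha =>
        hf.eq_of_forall_mul_right hf0 fun x => by
          rw [mul_zero, map_zero]; exact LinearMap.congr_fun ha x))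
  -- The integral is the element representing ε through the Frobenius form.
  obtain ⟨Λ, hΛ⟩ := hD counit
  have hΛ' : ∀ y, f (y * Λ) = counit (R := k) y := fun y => LinearMap.congr_fun hΛ y
  refine ⟨Λ, fun x => hf.eq_of_forall_mul_right hf0 fun y => ?_, ?_⟩
  · rw [← mul_assoc, hΛ', Bialgebra.counit_mul, mul_smul_comm, map_smul, hΛ', smul_eq_mul, mul_comm]
  · rw [← one_mul Λ, hΛ', Bialgebra.counit_one]

theorem IsLeftIntegral.eq_smul (hf : IsRightDualIntegral f) (hf0 : f ≠ 0) {Λ Λ' : H}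
    (hΛ : IsLeftIntegral k Λ) (h1 : f Λ = 1) (hΛ' : IsLeftIntegral k Λ') : Λ' = f Λ' • Λ :=
  hf.eq_of_forall_mul_right hf0 fun x => by
    rw [hΛ', mul_smul_comm, hΛ, map_smul, map_smul, map_smul, h1]
    simp [mul_comm]

theorem existsUnique_isDistinguishedGrouplike (hf : IsRightDualIntegral f) (hf0 : f ≠ 0) :
    ∃! ν : H →ₐ[k] k, IsDistinguishedGrouplike ν := by
  obtain ⟨Λ, hΛ, h1⟩ := hf.exists_isLeftIntegral hf0
  have key : ∀ x, Λ * x = f (Λ * x) • Λ := fun x => hΛ.eq_smul hf hf0 h1 (hΛ.mul_right x)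
  let ν : H →ₐ[k] k := AlgHom.ofLinearMap (f ∘ₗ LinearMap.mulLeft k Λ)
    (by simp [h1]) (fun x y => by
      simp only [LinearMap.comp_apply, LinearMap.mulLeft_apply]
      rw [← mul_assoc, key x, smul_mul_assoc, map_smul, map_smul, h1, smul_eq_mul, smul_eq_mul,
        mul_one])
  refine ⟨ν, fun Λ' hΛ' x => ?_, fun ν' hν' => ?_⟩
  · rw [hΛ.eq_smul hf hf0 h1 hΛ', smul_mul_assoc, key x, smul_comm]
    rfl
  · ext x
    change ν' x = f (Λ * x)
    rw [hν' Λ hΛ x, map_smul, h1, smul_eq_mul, mul_one]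

theorem IsLeftIntegral.sum_apply_antipode_mul_smul (hf : IsRightDualIntegral f) (hf0 : f ≠ 0)
    {Λ : H} (hΛ : IsLeftIntegral k Λ) (h1 : f Λ = 1) (x : H) :
    ∑ i ∈ (ℛ k Λ).index, f (antipode k ((ℛ k Λ).right i) * x) • (ℛ k Λ).left i = x := by
  refine hf.eq_of_forall_mul_right hf0 fun y => ?_
  conv_rhs => rw [← hΛ.sum_apply_mul_smul_antipode hf h1 y]
  simp only [Finset.mul_sum, Finset.sum_mul, map_sum, mul_smul_comm, smul_mul_assoc, map_smul,
    smul_eq_mul]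
  exact Finset.sum_congr rfl fun i _ => mul_comm _ _

/-- Radford's formula for the Nakayama automorphism of a right integral for `H^*`. -/
theorem IsRightDualIntegral.apply_mul_comm (hf : IsRightDualIntegral f) (hf0 : f ≠ 0)
    {ν : H →ₐ[k] k} (hν : IsDistinguishedGrouplike ν) (a y : H) :
    f (a * y) = f (antipode k (antipode k (hit ν.toLinearMap y)) * a) := by
  obtain ⟨Λ, hΛ, h1⟩ := hf.exists_isLeftIntegral hf0
  -- N is the Nakayama image of y. Its dual-basis expansion is S(f(Λ₍₁₎y)Λ₍₂₎); moving y to the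
  -- second leg of Δ(Λ) and using f(Λ₍₁₎)Λ₍₂₎ = 1 leaves S²(y↼ν).
  obtain ⟨N, hN⟩ := hf.exists_dualAct_eq hf0 (f ∘ₗ LinearMap.mulRight k y)
  have h2 : N = antipode k (contractFst f (comul Λ * (y ⊗ₜ[k] 1))) := by
    conv_lhs => rw [← hΛ.sum_apply_mul_smul_antipode hf h1 N]
    conv_rhs => rw [← (ℛ k Λ).eq]
    simp only [hN, Finset.sum_mul, map_sum, Algebra.TensorProduct.tmul_mul_tmul, mul_one,
      contractFst_tmul, map_smul, LinearMap.comp_apply, LinearMap.mulRight_apply]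
  rw [hΛ.comul_mul_tmul_one hν, contractFst_mul_one_tmul, ← hit_eq, hf, h1, one_smul, one_mul] at h2
  rw [← h2, hN]
  rfl

end Frobenius

/-! ### The R-matrix, the Drinfeld element u and h_ν. -/

section Quasitriangular

variable {k H : Type*} [Field k] [Ring H] [HopfAlgebra k H]

/-- `a ⊗ b ↦ S(b) a`. -/
def antipodeSndMul (k H : Type*) [Field k] [Ring H] [HopfAlgebra k H] : H ⊗[k] H →ₗ[k] H :=
  LinearMap.mul' k H ∘ₗ (antipode k (A := H)).rTensor H ∘ₗ flip k H

/-- `a ⊗ b ↦ a S(b)`. -/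
def mulAntipodeSnd (k H : Type*) [Field k] [Ring H] [HopfAlgebra k H] : H ⊗[k] H →ₗ[k] H :=
  LinearMap.mul' k H ∘ₗ (antipode k (A := H)).lTensor H

@[simp] theorem flip_tmul (a b : H) : flip k H (a ⊗ₜ b) = b ⊗ₜ a := rfl

@[simp] theorem antipodeSndMul_tmul (a b : H) :
    antipodeSndMul k H (a ⊗ₜ b) = antipode k b * a := by
  simp [antipodeSndMul]

@[simp] theorem mulAntipodeSnd_tmul (a b : H) :
    mulAntipodeSnd k H (a ⊗ₜ b) = a * antipode k b := by
  simp [mulAntipodeSnd]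

theorem antipodeSndMul_mul_tmul (X : H ⊗[k] H) (c d : H) :
    antipodeSndMul k H (X * (c ⊗ₜ d)) = antipode k d * antipodeSndMul k H X * c := by
  induction X with
  | zero => simp
  | tmul a b => simp [antipode_mul_antidistrib, mul_assoc]
  | add X Y hX hY => simp only [add_mul, mul_add, map_add, hX, hY]

theorem mulAntipodeSnd_tmul_mul (X : H ⊗[k] H) (c d : H) :
    mulAntipodeSnd k H ((c ⊗ₜ d) * X) = c * mulAntipodeSnd k H X * antipode k d := by
  induction X with
  | zero => simp
  | tmul a b => simp [antipode_mul_antidistrib, mul_assoc]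
  | add X Y hX hY => simp only [add_mul, mul_add, map_add, hX, hY]

theorem antipodeSndMul_flip_comul_mul (x : H) (X : H ⊗[k] H) :
    antipodeSndMul k H (flip k H (comul x) * X) =
      counit (R := k) x • antipodeSndMul k H X := by
  induction X with
  | zero => simp
  | add X Y hX hY => simp only [mul_add, map_add, hX, hY, smul_add]
  | tmul a b =>
    have h : antipodeSndMul k H (flip k H (comul x) * (a ⊗ₜ b)) =
        antipode k b * LinearMap.mul' k H ((antipode k).rTensor H (comul x)) * a := by
      generalize comul (R := k) x = Y
      induction Y with
      | zero => simp
      | tmul c d => simp [antipode_mul_antidistrib, mul_assoc]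
      | add X Y hX hY => simp only [add_mul, mul_add, map_add, hX, hY]
    rw [h, mul_antipode_rTensor_comul_apply, Algebra.algebraMap_eq_smul_one]
    simp

theorem sum_antipode_mul_mul_antipode_antipode (u x : H) :
    ∑ i ∈ (ℛ k x).index, antipode k (antipode k ((ℛ k x).right i)) *
      ∑ l ∈ (ℛ k ((ℛ k x).left i)).index, antipode k ((ℛ k ((ℛ k x).left i)).right l) * u *
        (ℛ k ((ℛ k x).left i)).left l = u * x := by
  have h := congrArg (LinearMap.mul' k H ∘ₗ
      TensorProduct.map (antipode k ∘ₗ LinearMap.mul' k H ∘ₗ (antipode k).lTensor H)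
        (LinearMap.mulLeft k u) ∘ₗ (TensorProduct.comm k H (H ⊗[k] H)).toLinearMap)
    (sum_tmul_tmul_eq (ℛ k x) (fun i => ℛ k _) (fun i => ℛ k _))
  simp only [map_sum, TensorProduct.map_tmul, LinearMap.lTensor_tmul, LinearMap.comp_apply,
    LinearMap.mul'_apply, LinearEquiv.coe_coe, TensorProduct.comm_tmul,
    LinearMap.mulLeft_apply] at h
  simp only [← Finset.sum_mul, ← map_sum, sum_mul_antipode_eq_algebraMap_counit,
    Algebra.algebraMap_eq_smul_one, map_smul, antipode_one] at h
  have h2 : ∑ i ∈ (ℛ k x).index,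
      (counit (R := k) ((ℛ k x).right i) • (1 : H)) * (u * (ℛ k x).left i) = u * x := by
    have := congrArg (fun z => u * TensorProduct.rid k H z) (sum_tmul_counit_eq (ℛ k x))
    simpa only [map_sum, TensorProduct.rid_tmul, Finset.mul_sum, one_smul, smul_mul_assoc, one_mul,
      mul_smul_comm] using this
  rw [← h2, ← h]
  refine Finset.sum_congr rfl fun i _ => ?_
  simp only [Finset.mul_sum, antipode_mul_antidistrib, mul_assoc]

namespace QuasitriangularStructure

variable (Q : QuasitriangularStructure k H)

theorem drinfeld_eq : Q.drinfeld = antipodeSndMul k H Q.R := rfl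

theorem lTensor_comul_eq_sum {s : Finset (H × H)} (hs : Q.R = ∑ i ∈ s, i.1 ⊗ₜ[k] i.2) :
    (comul (R := k) (A := H)).lTensor H Q.R =
      ∑ i ∈ s, ∑ j ∈ s, (i.1 * j.1) ⊗ₜ[k] (j.2 ⊗ₜ[k] i.2) := by
  rw [Q.lTensor_comul_R, hs, map_sum, map_sum, Finset.sum_mul_sum]
  simp [leg13, leg12]

theorem assoc_rTensor_comul_eq_sum {s : Finset (H × H)} (hs : Q.R = ∑ i ∈ s, i.1 ⊗ₜ[k] i.2) :
    TensorProduct.assoc k H H H ((comul (R := k) (A := H)).rTensor H Q.R) =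
      ∑ i ∈ s, ∑ j ∈ s, i.1 ⊗ₜ[k] (j.1 ⊗ₜ[k] (i.2 * j.2)) := by
  rw [Q.rTensor_comul_R, hs, map_sum, map_sum, Finset.sum_mul_sum]
  simp [leg13, leg23]

theorem contractFst_counit_R : contractFst counit Q.R = 1 := by
  obtain ⟨s, hs⟩ := TensorProduct.exists_finset Q.R
  have h := congrArg (TensorProduct.lid k (H ⊗[k] H) ∘
    (counit (R := k) (A := H)).rTensor (H ⊗[k] H)) (Q.assoc_rTensor_comul_eq_sum hs)
  have hl : ∀ X : H ⊗[k] H, TensorProduct.lid k (H ⊗[k] H)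
      ((counit (R := k) (A := H)).rTensor (H ⊗[k] H)
        (TensorProduct.assoc k H H H ((comul (R := k) (A := H)).rTensor H X))) = X := by
    intro X
    induction X with
    | zero => simp
    | add X Y hX hY => simp only [map_add, hX, hY]
    | tmul a b =>
      conv_rhs => rw [← hit_counit (k := k) a, hit_eq_sum, TensorProduct.sum_tmul]
      rw [LinearMap.rTensor_tmul, ← (ℛ k a).eq]
      simp [TensorProduct.sum_tmul, TensorProduct.smul_tmul']
  have hr : TensorProduct.lid k (H ⊗[k] H) ((counit (R := k) (A := H)).rTensor (H ⊗[k] H)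
      (∑ i ∈ s, ∑ j ∈ s, i.1 ⊗ₜ[k] (j.1 ⊗ₜ[k] (i.2 * j.2)))) =
      (1 ⊗ₜ contractFst counit Q.R) * Q.R := by
    rw [hs]
    simp [Finset.sum_mul_sum, TensorProduct.tmul_sum]
  rw [Function.comp_apply, Function.comp_apply, hl, hr] at h
  have h1 : (1 : H) ⊗ₜ[k] contractFst counit Q.R = 1 ⊗ₜ 1 :=
    Q.isUnit_R.mul_right_cancel (by rw [← h, ← Algebra.TensorProduct.one_def, one_mul])
  simpa using congrArg (contractFst (counit (R := k) (A := H))) h1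

theorem contractSnd_counit_R : contractSnd counit Q.R = 1 := by
  obtain ⟨s, hs⟩ := TensorProduct.exists_finset Q.R
  have h := congrArg ((contractFst (counit (R := k) (A := H))).lTensor H)
    (Q.lTensor_comul_eq_sum hs)
  have hl : ∀ X : H ⊗[k] H, (contractFst (counit (R := k) (A := H))).lTensor H
        ((comul (R := k) (A := H)).lTensor H X) = X := by
    intro X
    induction X with
    | zero => simp
    | add X Y hX hY => simp only [map_add, hX, hY]
    | tmul a b => rw [LinearMap.lTensor_tmul, LinearMap.lTensor_tmul, ← hit_eq, hit_counit]
  have hr : (contractFst (counit (R := k) (A := H))).lTensor H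
      (∑ i ∈ s, ∑ j ∈ s, (i.1 * j.1) ⊗ₜ[k] (j.2 ⊗ₜ[k] i.2)) =
      Q.R * (contractSnd counit Q.R ⊗ₜ 1) := by
    rw [hs]
    simp [Finset.sum_mul_sum, TensorProduct.sum_tmul, TensorProduct.smul_tmul']
  rw [hl, hr] at h
  have h1 : contractSnd counit Q.R ⊗ₜ[k] (1 : H) = 1 ⊗ₜ 1 :=
    Q.isUnit_R.mul_left_cancel (by rw [← h, ← Algebra.TensorProduct.one_def, mul_one])
  simpa using congrArg (contractSnd (counit (R := k) (A := H))) h1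

theorem rTensor_antipode_R_mul : (antipode k).rTensor H Q.R * Q.R = 1 := by
  obtain ⟨s, hs⟩ := TensorProduct.exists_finset Q.R
  have h := congrArg ((LinearMap.mul' k H ∘ₗ (antipode k).rTensor H).rTensor H ∘ₗ
    (TensorProduct.assoc k H H H).symm.toLinearMap) (Q.assoc_rTensor_comul_eq_sum hs)
  have hl : ∀ X : H ⊗[k] H, (LinearMap.mul' k H ∘ₗ (antipode k).rTensor H).rTensor H
        ((comul (R := k) (A := H)).rTensor H X) = 1 ⊗ₜ contractFst counit X := by
    intro X
    induction X with
    | zero => simp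
    | add X Y hX hY => simp only [map_add, hX, hY, TensorProduct.tmul_add]
    | tmul a b =>
      rw [LinearMap.rTensor_tmul, LinearMap.rTensor_tmul, LinearMap.comp_apply,
        mul_antipode_rTensor_comul_apply, Algebra.algebraMap_eq_smul_one, contractFst_tmul,
        TensorProduct.smul_tmul]
  have hr : ((LinearMap.mul' k H ∘ₗ (antipode k).rTensor H).rTensor H ∘ₗ
      (TensorProduct.assoc k H H H).symm.toLinearMap)
      (∑ i ∈ s, ∑ j ∈ s, i.1 ⊗ₜ[k] (j.1 ⊗ₜ[k] (i.2 * j.2))) =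
      (antipode k).rTensor H Q.R * Q.R := by
    rw [hs]
    simp [Finset.sum_mul_sum]
  rw [hr, LinearMap.comp_apply, LinearEquiv.coe_coe, LinearEquiv.symm_apply_apply, hl,
    Q.contractFst_counit_R] at h
  exact h.symm

theorem R_mul_rTensor_antipode : Q.R * (antipode k).rTensor H Q.R = 1 :=
  Q.isUnit_R.mul_right_cancel (by rw [mul_assoc, Q.rTensor_antipode_R_mul, mul_one, one_mul])

/-- Applying S ⊗ m(S ⊗ id) to (id ⊗ Δ)(R) = R₁₃R₁₂ shows that (S ⊗ S)(R) is a left inverse of (S ⊗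
id)(R) = R⁻¹. -/
theorem map_antipode_antipode_R : TensorProduct.map (antipode k) (antipode k) Q.R = Q.R := by
  obtain ⟨s, hs⟩ := TensorProduct.exists_finset Q.R
  have h := congrArg (TensorProduct.map (antipode k)
    (LinearMap.mul' k H ∘ₗ (antipode k).rTensor H)) (Q.lTensor_comul_eq_sum hs)
  have hl : ∀ X : H ⊗[k] H, TensorProduct.map (antipode k)
      (LinearMap.mul' k H ∘ₗ (antipode k).rTensor H) ((comul (R := k) (A := H)).lTensor H X) =
        antipode k (contractSnd counit X) ⊗ₜ 1 := by
    intro X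
    induction X with
    | zero => simp
    | add X Y hX hY => simp only [map_add, hX, hY, TensorProduct.add_tmul]
    | tmul a b =>
      rw [LinearMap.lTensor_tmul, TensorProduct.map_tmul, LinearMap.comp_apply,
        mul_antipode_rTensor_comul_apply, Algebra.algebraMap_eq_smul_one, contractSnd_tmul,
        map_smul, TensorProduct.smul_tmul]
  have hr : TensorProduct.map (antipode k) (LinearMap.mul' k H ∘ₗ (antipode k).rTensor H)
      (∑ i ∈ s, ∑ j ∈ s, (i.1 * j.1) ⊗ₜ[k] (j.2 ⊗ₜ[k] i.2)) =
      TensorProduct.map (antipode k) (antipode k) Q.R * (antipode k).rTensor H Q.R := by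
    rw [hs, Finset.sum_comm]
    simp [Finset.sum_mul_sum, antipode_mul_antidistrib]
  rw [hr, hl, Q.contractSnd_counit_R, antipode_one, ← Algebra.TensorProduct.one_def] at h
  calc _ = TensorProduct.map (antipode k) (antipode k) Q.R *
        ((antipode k).rTensor H Q.R * Q.R) := by rw [Q.rTensor_antipode_R_mul, mul_one]
    _ = Q.R := by rw [← mul_assoc, ← h, one_mul]

theorem antipode_drinfeld : antipode k Q.drinfeld = mulAntipodeSnd k H Q.R := by
  conv_rhs => rw [← Q.map_antipode_antipode_R]
  rw [drinfeld_eq]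
  generalize Q.R = X
  induction X with
  | zero => simp
  | tmul a b => simp [antipode_mul_antidistrib]
  | add X Y hX hY => simp only [map_add, hX, hY]

/-- Under a ⊗ b ↦ S(b)a, the relation RΔ(y) = σΔ(y)R becomes S(y₍₂₎)uy₍₁₎ = ε(y)u. Multiplying on
the left by S² of a third leg isolates ux. -/
theorem drinfeld_mul (x : H) :
    Q.drinfeld * x = antipode k (antipode k x) * Q.drinfeld := by
  have key : ∀ y : H, ∑ l ∈ (ℛ k y).index,
      antipode k ((ℛ k y).right l) * Q.drinfeld * (ℛ k y).left l =
        counit (R := k) y • Q.drinfeld := by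
    intro y
    rw [drinfeld_eq, ← antipodeSndMul_flip_comul_mul, ← Q.R_mul_comul]
    conv_rhs => rw [← (ℛ k y).eq]
    simp only [Finset.mul_sum, map_sum, antipodeSndMul_mul_tmul]
  rw [← sum_antipode_mul_mul_antipode_antipode (k := k)]
  simp only [key]
  conv_rhs => rw [← hit_counit (k := k) x, hit_eq_sum]
  simp [map_sum, Finset.sum_mul]

theorem drinfeld_mul_sum {s : Finset (H × H)} (hs : Q.R = ∑ i ∈ s, i.1 ⊗ₜ[k] i.2) :
    Q.drinfeld * ∑ i ∈ s, i.2 * antipode k (antipode k i.1) = 1 := by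
  have h := congrArg ((antipode k).rTensor H) Q.map_antipode_antipode_R
  have h2 : antipodeSndMul k H (Q.R * (antipode k).rTensor H
      (TensorProduct.map (antipode k) (antipode k) Q.R)) = 1 := by
    rw [h, Q.R_mul_rTensor_antipode, Algebra.TensorProduct.one_def]
    simp
  rw [← h2]
  conv_rhs => rw [hs, map_sum, map_sum, ← hs]
  simp only [Finset.mul_sum, map_sum, TensorProduct.map_tmul, LinearMap.rTensor_tmul,
    antipodeSndMul_mul_tmul, ← drinfeld_eq]
  exact Finset.sum_congr rfl fun i _ => by rw [← mul_assoc, Q.drinfeld_mul]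

theorem isUnit_drinfeld : IsUnit Q.drinfeld := by
  obtain ⟨s, hs⟩ := TensorProduct.exists_finset Q.R
  have h := Q.drinfeld_mul_sum hs
  -- A right inverse v of u satisfies 1 = uv = S²(v)u, so S²(v) is a left inverse and coincides with
  -- v.
  refine ⟨⟨_, _, h, ?_⟩, rfl⟩
  have h2 := h
  rw [Q.drinfeld_mul] at h2
  rw [left_inv_eq_right_inv h2 h] at h2
  exact h2

theorem antipode_bijective (Q : QuasitriangularStructure k H) :
    Function.Bijective (antipode k (A := H)) := by
  constructor
  · rw [← LinearMap.ker_eq_bot, LinearMap.ker_eq_bot']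
    intro x hx
    have h := Q.drinfeld_mul x
    rw [hx, map_zero, zero_mul] at h
    exact (Q.isUnit_drinfeld.mul_right_eq_zero).1 h
  · intro x
    obtain ⟨u, hu⟩ := Q.isUnit_drinfeld
    refine ⟨antipode k (↑u⁻¹ * x * ↑u), ?_⟩
    have h := Q.drinfeld_mul (↑u⁻¹ * x * ↑u)
    rw [← hu, ← mul_assoc, ← mul_assoc, Units.mul_inv, one_mul] at h
    exact (u.mul_left_inj.1 h).symm

theorem antipode_drinfeld_mul (x : H) :
    antipode k Q.drinfeld * antipode k (antipode k x) = x * antipode k Q.drinfeld := by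
  obtain ⟨y, rfl⟩ := Q.antipode_bijective.2 x
  rw [← antipode_mul_antidistrib, ← antipode_mul_antidistrib, ← Q.drinfeld_mul]

theorem antipode_antipode_drinfeld : antipode k (antipode k Q.drinfeld) = Q.drinfeld :=
  (Q.isUnit_drinfeld.mul_right_cancel (Q.drinfeld_mul _)).symm

theorem drinfeld_mul_antipode_drinfeld :
    Q.drinfeld * antipode k Q.drinfeld = antipode k Q.drinfeld * Q.drinfeld := by
  rw [Q.drinfeld_mul, Q.antipode_antipode_drinfeld]

/-- Replacing R₂₁ by its image under S ⊗ S yields the terms S(b)S(u)S²(a) = S(b)aS(u). -/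
theorem mulAntipodeSnd_flip_mul_R :
    mulAntipodeSnd k H (flip k H Q.R * Q.R) = Q.drinfeld * antipode k Q.drinfeld := by
  have h1 : ∀ X : H ⊗[k] H, mulAntipodeSnd k H
      (flip k H (TensorProduct.map (antipode k) (antipode k) X) * Q.R) =
      antipodeSndMul k H X * antipode k Q.drinfeld := by
    intro X
    induction X with
    | zero => simp
    | add X Y hX hY => simp only [map_add, add_mul, hX, hY]
    | tmul a b =>
      rw [TensorProduct.map_tmul, flip_tmul, mulAntipodeSnd_tmul_mul, ← Q.antipode_drinfeld,
        mul_assoc, Q.antipode_drinfeld_mul, antipodeSndMul_tmul, mul_assoc]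
  have h2 := h1 Q.R
  rwa [Q.map_antipode_antipode_R, ← drinfeld_eq] at h2

section Character

variable (ν : H →ₐ[k] k)

/-- S² is conjugation by u, which is invisible to a character with values in a field. -/
theorem character_antipode_antipode (Q : QuasitriangularStructure k H) (ν : H →ₐ[k] k)
    (x : H) : ν (antipode k (antipode k x)) = ν x := by
  have h := congrArg ν (Q.drinfeld_mul x)
  rw [map_mul, map_mul, mul_comm] at h
  exact (mul_right_cancel₀ (Q.isUnit_drinfeld.map ν).ne_zero h).symm

theorem hit_antipode_antipode (Q : QuasitriangularStructure k H) (ν : H →ₐ[k] k) (x : H) :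
    hit ν.toLinearMap (antipode k (antipode k x)) =
      antipode k (antipode k (hit ν.toLinearMap x)) := by
  rw [hit_eq, comul_antipode_antipode, hit_eq_sum, ← (ℛ k x).eq]
  simp [map_sum, Q.character_antipode_antipode]

theorem hElem_eq : Q.hElem ν = contractSnd ν.toLinearMap Q.R := rfl

theorem antipode_hElem : antipode k (Q.hElem ν) =
    contractSnd ν.toLinearMap ((antipode k).rTensor H Q.R) := by
  rw [hElem_eq]
  generalize Q.R = X
  induction X with
  | zero => simp
  | tmul a b => simp
  | add X Y hX hY => simp only [map_add, hX, hY]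

theorem hElem_mul_antipode_hElem : Q.hElem ν * antipode k (Q.hElem ν) = 1 := by
  rw [antipode_hElem, hElem_eq, ← contractSnd_mul, Q.R_mul_rTensor_antipode, contractSnd_one]

theorem antipode_hElem_mul_hElem : antipode k (Q.hElem ν) * Q.hElem ν = 1 := by
  rw [antipode_hElem, hElem_eq, ← contractSnd_mul, Q.rTensor_antipode_R_mul, contractSnd_one]

theorem antipode_antipode_hElem : antipode k (antipode k (Q.hElem ν)) = Q.hElem ν := by
  have h := congrArg (antipode k) (Q.antipode_hElem_mul_hElem ν)
  rw [antipode_mul_antidistrib, antipode_one] at h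
  exact (left_inv_eq_right_inv (Q.hElem_mul_antipode_hElem ν) h).symm

theorem drinfeld_mul_hElem : Q.drinfeld * Q.hElem ν = Q.hElem ν * Q.drinfeld := by
  rw [Q.drinfeld_mul, Q.antipode_antipode_hElem]

/-- `S(b ↼ ν) a = u h_ν`, summed over `R = ∑ a ⊗ b`. -/
theorem antipodeSndMul_lTensor_hit_R :
    antipodeSndMul k H ((hit ν.toLinearMap).lTensor H Q.R) = Q.drinfeld * Q.hElem ν := by
  obtain ⟨s, hs⟩ := TensorProduct.exists_finset Q.R
  have h := congrArg (antipodeSndMul k H ∘ₗ (contractFst ν.toLinearMap).lTensor H)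
    (Q.lTensor_comul_eq_sum hs)
  have hl : (contractFst ν.toLinearMap).lTensor H ((comul (R := k) (A := H)).lTensor H Q.R) =
      (hit ν.toLinearMap).lTensor H Q.R := by
    rw [← LinearMap.comp_apply, ← LinearMap.lTensor_comp]
    rfl
  rw [LinearMap.comp_apply, hl] at h
  rw [h, drinfeld_eq, hElem_eq, hs]
  simp [Finset.sum_mul_sum, mul_assoc]

end Character

variable [FiniteDimensional k H] {f : Module.Dual k H}

/-- The composite of a right integral for `H^*` with the antipode is `λ · c`, where
`u = h_ν⁻¹ S(u) c`. -/
theorem exists_apply_antipode_eq (hf : IsRightDualIntegral f) (hf0 : f ≠ 0) {ν : H →ₐ[k] k}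
    (hν : IsDistinguishedGrouplike ν) :
    ∃ c : H, Q.hElem ν * Q.drinfeld = antipode k Q.drinfeld * c ∧
      ∀ x, f (antipode k x) = f (c * x) := by
  obtain ⟨Λ, hΛ, h1⟩ := hf.exists_isLeftIntegral hf0
  obtain ⟨c, hc⟩ := hf.exists_dualAct_eq hf0 (f ∘ₗ antipode k)
  set l : Module.Dual k H := f ∘ₗ antipode k with hl
  have hfst : c = antipode k (contractFst l (comul Λ)) := by
    conv_lhs => rw [← hΛ.sum_apply_mul_smul_antipode hf h1 c]
    rw [← (ℛ k Λ).eq]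
    simp [hc]
  -- This is the other dual-basis expansion, applied to 1.
  have hsnd : contractSnd l (comul Λ) = 1 := by
    conv_rhs => rw [← hΛ.sum_apply_antipode_mul_smul hf hf0 h1 1]
    conv_lhs => rw [← (ℛ k Λ).eq]
    simp [hl]
  have hleft : ∀ X : H ⊗[k] H, contractSnd l (X * comul Λ) = mulAntipodeSnd k H X := by
    intro X
    induction X with
    | zero => simp
    | add X Y hX hY => simp only [add_mul, map_add, hX, hY]
    | tmul a b =>
      have hab : a ⊗ₜ[k] b = (a ⊗ₜ 1) * (1 ⊗ₜ b) := by simp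
      rw [hab, mul_assoc, hΛ.one_tmul_mul_comul, contractSnd_tmul_one_mul,
        contractSnd_tmul_one_mul, hsnd]
      simp
  have hflip : ∀ X : H ⊗[k] H, contractSnd l (flip k H X) = contractFst l X := by
    intro X
    induction X with
    | zero => simp
    | add X Y hX hY => simp only [map_add, hX, hY]
    | tmul a b => simp
  have hflip_mul : ∀ (X : H ⊗[k] H) (a b : H),
      flip k H X * (a ⊗ₜ b) = flip k H (X * (b ⊗ₜ a)) := by
    intro X a b
    induction X with
    | zero => simp
    | add X Y hX hY => simp only [add_mul, map_add, hX, hY]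
    | tmul c d => simp
  have hright : ∀ X : H ⊗[k] H, contractSnd l (flip k H (comul Λ) * X) =
      contractFst l (comul Λ) * antipodeSndMul k H ((hit ν.toLinearMap).lTensor H X) := by
    intro X
    induction X with
    | zero => simp
    | add X Y hX hY => simp only [mul_add, map_add, hX, hY]
    | tmul a b =>
      have hba : b ⊗ₜ[k] a = (b ⊗ₜ 1) * (1 ⊗ₜ a) := by simp
      rw [hflip_mul, hflip, hba, ← mul_assoc, hΛ.comul_mul_tmul_one hν,
        contractFst_mul_one_tmul, contractFst_mul_one_tmul, LinearMap.lTensor_tmul,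
        antipodeSndMul_tmul, mul_assoc]
  -- The contraction reads S(u) = l(Λ₍₁₎)Λ₍₂₎ · u h_ν; applying S brings in c = S(l(Λ₍₁₎)Λ₍₂₎).
  have h := congrArg (contractSnd l) (Q.R_mul_comul Λ)
  rw [hleft, hright, ← Q.antipode_drinfeld, Q.antipodeSndMul_lTensor_hit_R] at h
  have h2 := congrArg (antipode k) h
  rw [Q.antipode_antipode_drinfeld, antipode_mul_antidistrib, ← hfst, antipode_mul_antidistrib]
    at h2
  refine ⟨c, ?_, fun x => (hc x).symm⟩
  conv_lhs => rw [h2]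
  rw [← mul_assoc, ← mul_assoc, Q.hElem_mul_antipode_hElem, one_mul]

end QuasitriangularStructure

/-! ### The twist θ and the element G. -/

namespace RibbonStructure

variable (B : RibbonStructure k H)

theorem counit_θ : counit (R := k) B.θ = 1 := by
  have hflip : ∀ X : H ⊗[k] H, contractFst (counit (R := k) (A := H)) (flip k H X) =
      contractSnd counit X := by
    intro X
    induction X with
    | zero => simp
    | add X Y hX hY => simp only [map_add, hX, hY]
    | tmul a b => simp
  have h := congrArg (contractFst (Bialgebra.counitAlgHom k H).toLinearMap) B.comul_θ
  rw [contractFst_mul, contractFst_mul, Bialgebra.toLinearMap_counitAlgHom, ← hit_eq, hit_counit,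
    hflip, B.contractSnd_counit_R, B.contractFst_counit_R, contractFst_tmul, mul_one, mul_one] at h
  have h2 : counit (R := k) B.θ • (1 : H) = 1 :=
    B.isUnit_θ.mul_right_cancel (by rw [smul_mul_assoc, one_mul, ← h])
  simpa using congrArg (counit (R := k) (A := H)) h2

theorem specialGrouplike_eq : B.specialGrouplike = B.θ * B.drinfeld := rfl

/-- Apply a ⊗ b ↦ aS(b) to Δ(θ) = (θ ⊗ θ)R₂₁R: one side is ε(θ) = 1, the other is θuS(u)S(θ). -/
theorem θ_mul_θ_mul_drinfeld : B.θ * (B.θ * (B.drinfeld * antipode k B.drinfeld)) = 1 := by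
  have h := congrArg (mulAntipodeSnd k H) B.comul_θ
  rw [mulAntipodeSnd_tmul_mul, B.mulAntipodeSnd_flip_mul_R, B.antipode_θ] at h
  have h2 : mulAntipodeSnd k H (comul B.θ) = 1 := by
    refine (mul_antipode_lTensor_comul_apply B.θ).trans ?_
    rw [B.counit_θ, map_one]
  rw [← h2, h, B.θ_central (_ * _)]

theorem antipode_specialGrouplike :
    antipode k B.specialGrouplike = antipode k B.drinfeld * B.θ := by
  rw [specialGrouplike_eq, antipode_mul_antidistrib, B.antipode_θ]

theorem specialGrouplike_mul_antipode :
    B.specialGrouplike * antipode k B.specialGrouplike = 1 := by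
  rw [antipode_specialGrouplike, specialGrouplike_eq, ← B.θ_central, ← B.θ_mul_θ_mul_drinfeld,
    mul_assoc, ← mul_assoc B.drinfeld, ← B.θ_central B.drinfeld, mul_assoc B.θ B.drinfeld]

theorem antipode_mul_specialGrouplike :
    antipode k B.specialGrouplike * B.specialGrouplike = 1 := by
  rw [antipode_specialGrouplike, specialGrouplike_eq, ← B.θ_central, mul_assoc, ← mul_assoc _ B.θ,
    ← B.θ_central, mul_assoc, ← B.drinfeld_mul_antipode_drinfeld, B.θ_mul_θ_mul_drinfeld]

theorem specialGrouplike_mul (x : H) :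
    B.specialGrouplike * x = antipode k (antipode k x) * B.specialGrouplike := by
  rw [specialGrouplike_eq, mul_assoc, B.drinfeld_mul, ← mul_assoc, B.θ_central, mul_assoc]

variable [FiniteDimensional k H] {f : Module.Dual k H}

/-- Since S(u)⁻¹ = θ²u and h_ν commutes with u, the element c with S(u)c = h_ν u is h_ν θ²u² = h_ν
G². -/
theorem apply_antipode (hf : IsRightDualIntegral f) (hf0 : f ≠ 0) {ν : H →ₐ[k] k}
    (hν : IsDistinguishedGrouplike ν) (x : H) :
    f (antipode k x) = f (B.hElem ν * (B.specialGrouplike * B.specialGrouplike) * x) := by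
  obtain ⟨c, hc, hcx⟩ := B.exists_apply_antipode_eq hf hf0 hν
  have hc2 : c = B.hElem ν * (B.specialGrouplike * B.specialGrouplike) := by
    have h1 : B.θ * (B.θ * (B.drinfeld * (antipode k B.drinfeld * c))) = c := by
      rw [← one_mul c]
      conv_rhs => rw [← B.θ_mul_θ_mul_drinfeld]
      simp only [mul_assoc, one_mul]
    have h2 : ∀ y z : H, y * (B.θ * z) = B.θ * (y * z) := fun y z => by
      rw [← mul_assoc, ← B.θ_central, mul_assoc]
    rw [← h1, ← hc, ← mul_assoc B.drinfeld, B.drinfeld_mul_hElem, specialGrouplike_eq]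
    simp only [mul_assoc, h2]
  rw [hcx, hc2]

end RibbonStructure

end Quasitriangular

/-! ### Translation of the trace conditions into L(H) and T. -/

section Traces

variable {k H : Type*} [Field k] [Ring H] [HopfAlgebra k H]

@[simp] theorem dualAct_apply (f : Module.Dual k H) (a x : H) : dualAct f a x = f (a * x) := rfl

theorem mem_twistedCenter {ν : H →ₐ[k] k} {z : H} :
    z ∈ twistedCenter ν ↔ ∀ x : H, hit ν.toLinearMap x * z = z * x := Iff.rfl

theorem mem_traceSpace {t : Module.Dual k H} :
    t ∈ traceSpace k H ↔ (∀ x y : H, t (x * y) = t (y * x)) ∧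
      ∀ x : H, t (antipode k x) = t x := Iff.rfl

namespace QuasitriangularStructure

variable (Q : QuasitriangularStructure k H)

theorem T_apply (ν : H →ₐ[k] k) (z : H) :
    Q.T ν z = hit ν.toLinearMap (antipode k z) * Q.hElem ν := rfl

end QuasitriangularStructure

theorem twistedCenter_eq_center {ν : H →ₐ[k] k} (hν : ν = Bialgebra.counitAlgHom k H) :
    twistedCenter ν = Subalgebra.toSubmodule (Subalgebra.center k H) := by
  ext z
  rw [mem_twistedCenter, Subalgebra.mem_toSubmodule, Subalgebra.mem_center_iff, hν]
  simp only [Bialgebra.toLinearMap_counitAlgHom, hit_counit]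

theorem QuasitriangularStructure.T_eq_antipode (Q : QuasitriangularStructure k H) {ν : H →ₐ[k] k}
    (hν : ν = Bialgebra.counitAlgHom k H) : Q.T ν = antipode k := by
  ext z
  rw [Q.T_apply, Q.hElem_eq, hν, Bialgebra.toLinearMap_counitAlgHom, hit_counit,
    Q.contractSnd_counit_R, mul_one]

variable [FiniteDimensional k H] {f : Module.Dual k H}

theorem IsDistinguishedGrouplike.eq_counit_of_isUnimodular (hf : IsRightDualIntegral f)
    (hf0 : f ≠ 0) {ν : H →ₐ[k] k} (hν : IsDistinguishedGrouplike ν) (hH : IsUnimodular k H) :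
    ν = Bialgebra.counitAlgHom k H := by
  obtain ⟨Λ, hΛ, h1⟩ := hf.exists_isLeftIntegral hf0
  ext x
  have h := congrArg f ((hν Λ hΛ x).symm.trans ((hH Λ).1 hΛ x))
  simpa [h1] using h

namespace RibbonStructure

variable (B : RibbonStructure k H)

theorem dualAct_mul_comm_iff (hf : IsRightDualIntegral f) (hf0 : f ≠ 0) {ν : H →ₐ[k] k}
    (hν : IsDistinguishedGrouplike ν) (z : H) :
    (∀ x y : H, dualAct f (z * B.specialGrouplike) (x * y) =
      dualAct f (z * B.specialGrouplike) (y * x)) ↔ z ∈ twistedCenter ν := by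
  set G := B.specialGrouplike with hG
  have h1 : ∀ x y : H, dualAct f (z * G) (x * y) =
      f (hit ν.toLinearMap (antipode k (antipode k y)) * z * G * x) := fun x y => by
    rw [dualAct_apply, ← mul_assoc, hf.apply_mul_comm hf0 hν, ← B.hit_antipode_antipode]
    simp only [mul_assoc]
  have h2 : ∀ x y : H, dualAct f (z * G) (y * x) =
      f (z * antipode k (antipode k y) * G * x) := fun x y => by
    rw [dualAct_apply, ← mul_assoc, mul_assoc z, B.specialGrouplike_mul, ← mul_assoc]
  rw [mem_twistedCenter]
  constructor
  · intro h x
    obtain ⟨y, rfl⟩ := (B.antipode_bijective.2.comp B.antipode_bijective.2) x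
    have h3 := hf.eq_of_forall_mul_left hf0
      fun x => (h1 x y).symm.trans ((h x y).trans (h2 x y))
    have h4 := congrArg (fun w => w * antipode k G) h3
    simp only [mul_assoc, hG, B.specialGrouplike_mul_antipode, mul_one] at h4
    exact h4
  · intro h x y
    rw [h1, h2, h]

theorem dualAct_antipode_iff (hf : IsRightDualIntegral f) (hf0 : f ≠ 0) {ν : H →ₐ[k] k}
    (hν : IsDistinguishedGrouplike ν) {z : H} (hz : z ∈ twistedCenter ν) :
    (∀ x : H, dualAct f (z * B.specialGrouplike) (antipode k x) =
      dualAct f (z * B.specialGrouplike) x) ↔ B.T ν z = z := by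
  have hGi : B.specialGrouplike * antipode k B.specialGrouplike = 1 :=
    B.specialGrouplike_mul_antipode
  have hiG := B.antipode_mul_specialGrouplike
  have hS := B.apply_antipode hf hf0 hν
  set G := B.specialGrouplike
  set K := hit ν.toLinearMap (antipode k G) with hK
  have hKz : K * z = z * antipode k G := hz _
  have hGK : hit ν.toLinearMap G * K = 1 := by rw [hK, ← hit_mul, hGi, hit_one]
  have h1 : ∀ x, dualAct f (z * G) (antipode k x) = f (K * B.T ν z * (G * G) * x) := by
    intro x
    -- With zG = S(w), the product zG S(x) becomes S(xw), so the formula for f∘S applies; the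
    -- Nakayama automorphism then carries w to the front.
    obtain ⟨w, hw⟩ := B.antipode_bijective.2 (z * G)
    rw [dualAct_apply, ← hw, ← antipode_mul_antidistrib, hS, ← mul_assoc, hf.apply_mul_comm hf0 hν,
      ← B.hit_antipode_antipode, hw, antipode_mul_antidistrib, hit_mul, B.T_apply]
    simp only [hK, mul_assoc]
  -- Membership in L(H), tested at S(G), gives Kz = zS(G). Both forms now appear as f(K · G² x), and
  -- K and G can be cancelled.
  have h2 : K * z * (G * G) = z * G := by
    rw [hKz, mul_assoc, ← mul_assoc _ G, hiG, one_mul]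
  constructor
  · intro h
    have h3 : K * B.T ν z * (G * G) = K * z * (G * G) := by
      rw [h2]
      exact hf.eq_of_forall_mul_left hf0 fun x => (h1 x).symm.trans (h x)
    have h4 := congrArg
      (fun w => hit ν.toLinearMap G * w * (antipode k G * antipode k G)) h3
    have h5 : ∀ y : H, hit ν.toLinearMap G * (K * y * (G * G)) * (antipode k G * antipode k G) =
        y := by
      intro y
      calc _ = (hit ν.toLinearMap G * K) * y * (G * (G * antipode k G) * antipode k G) := by
            simp only [mul_assoc]
        _ = y := by rw [hGK, hGi, mul_one, hGi, one_mul, mul_one]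
    simpa only [h5] using h4
  · intro h x
    rw [h1, h, h2, dualAct_apply]

theorem dualAct_mem_traceSpace_iff (hf : IsRightDualIntegral f) (hf0 : f ≠ 0) {ν : H →ₐ[k] k}
    (hν : IsDistinguishedGrouplike ν) (z : H) :
    dualAct f (z * B.specialGrouplike) ∈ traceSpace k H ↔
      z ∈ twistedCenter ν ⊓ LinearMap.eqLocus (B.T ν) LinearMap.id := by
  rw [mem_traceSpace, B.dualAct_mul_comm_iff hf hf0 hν, Submodule.mem_inf]
  exact and_congr_right fun hz => B.dualAct_antipode_iff hf hf0 hν hz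

theorem parametrizesTraces (hf : IsRightDualIntegral f) (hf0 : f ≠ 0) {ν : H →ₐ[k] k}
    (hν : IsDistinguishedGrouplike ν) :
    ParametrizesTraces (twistedCenter ν ⊓ LinearMap.eqLocus (B.T ν) LinearMap.id) f
      B.specialGrouplike := by
  set P := twistedCenter ν ⊓ LinearMap.eqLocus (B.T ν) LinearMap.id
  have hmem := B.dualAct_mem_traceSpace_iff hf hf0 hν
  let E : H →ₗ[k] Module.Dual k H :=
    (LinearMap.mul k H).compr₂ f ∘ₗ LinearMap.mulRight k B.specialGrouplike
  have hE : ∀ z, E z = dualAct f (z * B.specialGrouplike) := fun _ => rfl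
  let e : P →ₗ[k] traceSpace k H :=
    (E ∘ₗ P.subtype).codRestrict (traceSpace k H) fun z => (hmem z).2 z.2
  refine ⟨LinearEquiv.ofBijective e ⟨fun z w hzw => ?_, fun t => ?_⟩, fun z => rfl⟩
  · have h1 : E z = E w := congrArg Subtype.val hzw
    have h2 := hf.eq_of_forall_mul_left hf0 fun x => LinearMap.congr_fun h1 x
    have h3 := congrArg (fun y => y * antipode k B.specialGrouplike) h2
    refine Subtype.ext ?_
    simpa only [LinearMap.mulRight_apply, mul_assoc, B.specialGrouplike_mul_antipode,
      mul_one] using h3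
  · obtain ⟨a, ha⟩ := hf.exists_dualAct_eq hf0 t
    have h1 : dualAct f (a * antipode k B.specialGrouplike * B.specialGrouplike) = t := by
      rw [mul_assoc, B.antipode_mul_specialGrouplike, mul_one]
      exact LinearMap.ext ha
    refine ⟨⟨a * antipode k B.specialGrouplike, (hmem _).1 ?_⟩, Subtype.ext h1⟩
    rw [h1]
    exact t.2

end RibbonStructure

end Traces

end RibbonHopf

end

theorem mainTheorem12 {k H : Type*} [Field k] [Ring H] [HopfAlgebra k H]
    [FiniteDimensional k H] (B : RibbonHopf.RibbonStructure k H) :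
    (∃ lam : Module.Dual k H, lam ≠ 0 ∧ RibbonHopf.IsRightDualIntegral lam) ∧
    (∃! ν : H →ₐ[k] k, RibbonHopf.IsDistinguishedGrouplike ν) ∧
    ∀ lam : Module.Dual k H, lam ≠ 0 → RibbonHopf.IsRightDualIntegral lam →
    ∀ ν : H →ₐ[k] k, RibbonHopf.IsDistinguishedGrouplike ν →
      RibbonHopf.ParametrizesTraces
        (RibbonHopf.twistedCenter ν ⊓ LinearMap.eqLocus (B.T ν) LinearMap.id)
        lam B.specialGrouplike ∧
      (RibbonHopf.IsUnimodular k H →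
        RibbonHopf.twistedCenter ν = Subalgebra.toSubmodule (Subalgebra.center k H) ∧
        B.T ν = HopfAlgebra.antipode k ∧
        RibbonHopf.ParametrizesTraces
          (Subalgebra.toSubmodule (Subalgebra.center k H) ⊓
            LinearMap.eqLocus (HopfAlgebra.antipode k) LinearMap.id)
          lam B.specialGrouplike) := by
  obtain ⟨f, hf0, hf⟩ := RibbonHopf.exists_isRightDualIntegral k H
  refine ⟨⟨f, hf0, hf⟩, RibbonHopf.existsUnique_isDistinguishedGrouplike hf hf0,
    fun lam hlam0 hlam ν hν => ?_⟩
  have hmain := B.parametrizesTraces hlam hlam0 hν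
  refine ⟨hmain, fun hH => ?_⟩
  have hε := hν.eq_counit_of_isUnimodular hlam hlam0 hH
  have hL := RibbonHopf.twistedCenter_eq_center hε
  have hT := B.T_eq_antipode hε
  rw [hL, hT] at hmain
  exact ⟨hL, hT, hmain⟩
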